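/- **Model.** Let $\mathcal S$ be a finite set with a probability distribution $P_S$, let $\mathcal A=\{1,\dots,K\}$ with $K\ge 1$, and let $N\ge1$ be the number of agents. Each pair $(s,a)$ has an unknown parameter $\theta(s,a)$ in a measurable space; the parameters are independent, $\theta(s,a)$ having a given prior law. Given $\theta(s,a)=e$, the reward of arm $a$ in state $s$ has law $P_R(\cdot\mid s,a,e)$ with a density, jointly measurable in parameter and reward, with respect to a fixed $\sigma$-finite measure on $\mathbb R$, and has finite mean $\mu(s,a)$. (Exponential families with arbitrary priors are included.) The optimal arm of state $s$ is $a^*(s)=\arg\max_a\mu(s,a)$, the smallest index being chosen among several maximisers. In rounds $h=1,2,\dots$, given $\theta$ and the states, actions and rewards of all agents in rounds $1,\dots,h-1$, the $N$ agents act independently of each other: agent $n$ observes $s_h^n\sim P_S$, takes action $A_h^n\sim\pi_h(\cdot\mid s_h^n)$, and receives a reward with law $P_R(\cdot\mid s_h^n,A_h^n,\theta(s_h^n,A_h^n))$. Under *Thompson sampling*, $\pi_h(a\mid s)$ is the probability that $a$ is the (smallest) maximiser of $b\mapsto\hat\mu(s,b)$, where the $\hat\mu(s,b)$, $b\in\mathcal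 A$, are independent and $\hat\mu(s,b)$ has the posterior law of $\mu(s,b)$ obtained by Bayes' formula from the prior and all rewards observed in state $s$ under arm $b$ during rounds $1,\dots,h-1$. The *Bayesian system regret* is $$\mathrm{BR}(\pi,H)=\mathbb E\Big[\sum_{h=1}^H\sum_{n=1}^N \mu(s_h^n,a^*(s_h^n))-\mu(s_h^n,A_h^n)\Big]\in[0,\infty],$$ the expectation being over the instance $\theta$, the states, the actions and the rewards. For a conditional law $p(a\mid s)$ let $I_p(S;A)$ and $H_p(A)$ be the mutual information and the entropy of the action (in bits) when $(S,A)\sim P_S(s)\,p(a\mid s)$. Let $H(A^*)$ be the entropy of $\pi^*(a)=\sum_{s:\,a^*(s)=a}P_S(s)$; it depends on $\theta$ through $a^*$. **Lemma.** If Thompson sampling has sub-linear Bayesian system regret, i.e. $\lim_{H\to\infty}\mathrm{BR}(\pi,H)/H=0$, then almost surely $$\lim_{h\to\infty} I_{\pi_h}(S;A)=\lim_{h\to\infty}H_{\pi_h}(A)=H(A^*).$$ -/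

import Mathlib

open MeasureTheory Filter Topology
open scoped ENNReal

noncomputable section

/-! ### Finite information measures, in bits -/

/-- Shannon entropy (in bits) of a distribution on a finite set, with `0 log 0 = 0`. -/
def entropyBits {α : Type*} [Fintype α] (p : α → ℝ) : ℝ :=
  -∑ a, p a * Real.logb 2 (p a)

/-- Mutual information (in bits) of the two coordinates of a joint distribution `q`:
`∑ q(s,a) log₂ (q(s,a) / (q_S(s) q_A(a)))`. Terms with `q(s,a) = 0` vanish. -/
def mutualInfoBits {α β : Type*} [Fintype α] [Fintype β] (q : α → β → ℝ) : ℝ :=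
  ∑ s, ∑ a, q s a * Real.logb 2 (q s a / ((∑ b, q s b) * (∑ t, q t a)))

/-! ### The optimal arm -/

open Classical in
/-- The set of maximisers of a vector of means. -/
def maximizers {K : ℕ} (m : Fin K → ℝ) : Finset (Fin K) :=
  Finset.univ.filter fun a => ∀ b, m b ≤ m a

theorem maximizers_nonempty {K : ℕ} [NeZero K] (m : Fin K → ℝ) : (maximizers m).Nonempty := by
  obtain ⟨a, ha⟩ := Finite.exists_max m
  exact ⟨a, by simpa [maximizers] using ha⟩

/-- `argmax` of a vector of means; among several maximisers the one of smallest index. -/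
def bestArm {K : ℕ} [NeZero K] (m : Fin K → ℝ) : Fin K :=
  (maximizers m).min' (maximizers_nonempty m)

/-! ### Contextual bandit model -/

/-- A Bayesian contextual bandit with finite state set `S` and arms `Fin K`. The pair `(s, a)` has an
unknown parameter in `E`, drawn from `prior s a`; the reward in state `s` under arm `a` and
parameter `e` has density `density s a e` with respect to the reference measure `ref`. -/
structure BayesBandit (S : Type*) (K : ℕ) (E : Type*) [MeasurableSpace E] where
  /-- the distribution `P_S` of the states -/
  stateLaw : PMF S
  /-- prior distribution of the parameter of `(s, a)` -/
  prior : S → Fin K → Measure E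
  isProbabilityMeasure_prior : ∀ s a, IsProbabilityMeasure (prior s a)
  /-- reference measure on rewards, for example Lebesgue measure or a counting measure -/
  ref : Measure ℝ
  sigmaFinite_ref : SigmaFinite ref
  /-- reward densities -/
  density : S → Fin K → E → ℝ → ℝ≥0∞
  measurable_density : ∀ s a, Measurable fun x : E × ℝ => density s a x.1 x.2
  lintegral_density : ∀ s a e, ∫⁻ r, density s a e r ∂ref = 1
  integrable_reward : ∀ s a e, Integrable (fun r : ℝ => r) (ref.withDensity (density s a e))

/-- Observations of `h` rounds: for each round and each of the `N` agents, the triple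
(state, action, reward). -/
abbrev History (S : Type*) (K N h : ℕ) : Type _ := Fin h → Fin N → S × Fin K × ℝ

/-- A policy shared by all agents: in round `h` (counted from `0`) it maps the observations of
the `h` previous rounds and a state to weights on the arms. -/
abbrev Policy (S : Type*) (K N : ℕ) : Type _ := (h : ℕ) → History S K N h → S → Fin K → ℝ≥0∞

namespace BayesBandit

variable {S : Type*} {K : ℕ} {E : Type*} [MeasurableSpace E]

/-- The reward distribution `P_R(· | s, a)` when the parameter of `(s, a)` is `e`. -/
def rewardLaw (M : BayesBandit S K E) (s : S) (a : Fin K) (e : E) : Measure ℝ :=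
  M.ref.withDensity (M.density s a e)

/-- The mean reward of `(s, a)` when its parameter is `e`. -/
def mean (M : BayesBandit S K E) (s : S) (a : Fin K) (e : E) : ℝ :=
  ∫ r, r ∂(M.rewardLaw s a e)

/-- The optimal arm `a*(s)` of the problem instance `θ`. -/
def optArm [NeZero K] (M : BayesBandit S K E) (θ : S × Fin K → E) (s : S) : Fin K :=
  bestArm fun a => M.mean s a (θ (s, a))

/-! ### Thompson sampling -/

open Classical in
/-- Likelihood of the parameter `e` of `(s, a)`: the product of the densities of all rewards
observed so far in state `s` under arm `a`. -/
def likelihood (M : BayesBandit S K E) {N h : ℕ} (x : History S K N h) (s : S) (a : Fin K)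
    (e : E) : ℝ≥0∞ :=
  ∏ i, ∏ n, if (x i n).1 = s ∧ (x i n).2.1 = a then M.density s a e (x i n).2.2 else 1

/-- Normalising constant in Bayes' formula. -/
def evidence (M : BayesBandit S K E) {N h : ℕ} (x : History S K N h) (s : S) (a : Fin K) : ℝ≥0∞ :=
  ∫⁻ e, M.likelihood x s a e ∂(M.prior s a)

open Classical in
/-- Posterior distribution of the parameter of `(s, a)` by Bayes' formula. If the normalising
constant is `0` or `∞` (which has probability zero) it is the prior, by convention. -/
def posterior (M : BayesBandit S K E) {N h : ℕ} (x : History S K N h) (s : S) (a : Fin K) :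
    Measure E :=
  if M.evidence x s a = 0 ∨ M.evidence x s a = ∞ then M.prior s a
  else (M.evidence x s a)⁻¹ • (M.prior s a).withDensity (M.likelihood x s a)

/-- Posterior distribution of the mean reward of `(s, a)`. -/
def meanPosterior (M : BayesBandit S K E) {N h : ℕ} (x : History S K N h) (s : S) (a : Fin K) :
    Measure ℝ :=
  (M.posterior x s a).map (M.mean s a)

/-- The Thompson sampling policy: in state `s`, sample independently for each arm a mean from its
posterior distribution and play the arm with the largest sampled mean. -/
def thompson [NeZero K] (M : BayesBandit S K E) (N : ℕ) : Policy S K N :=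
  fun _ x s a => Measure.pi (fun b => M.meanPosterior x s b) {m | bestArm m = a}

/-! ### Interaction of the agents with the environment -/

/-- The first `h` rounds of a sequence of observations. -/
def past {Ω : Type*} {N : ℕ} (Y : ℕ → Ω → Fin N → S × Fin K × ℝ) (h : ℕ) (ω : Ω) :
    History S K N h :=
  fun i => Y i ω

/-- Under `P`, the random instance `θ` and the observations `Y h ω n = (s_h^n, a_h^n, r_h^n)` arise
from `N` agents using the policy `π` in the bandit `M`:
the parameters are independent with their prior laws, and conditionally on the instance and the
past, the agents act independently in round `h`, each having state distribution `P_S`, action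
distribution `π_h(· | s)` given the state, and reward distribution `P_R(· | s, a)` given the state
and the action. -/
structure IsInteraction [MeasurableSpace S] [Fintype S] (M : BayesBandit S K E) {N : ℕ}
    (π : Policy S K N) {Ω : Type*} [MeasurableSpace Ω] (P : Measure Ω) (θ : Ω → S × Fin K → E)
    (Y : ℕ → Ω → Fin N → S × Fin K × ℝ) : Prop where
  measurable_instance : Measurable θ
  measurable_obs : ∀ h, Measurable (Y h)
  instance_law : P.map θ = Measure.pi fun i : S × Fin K => M.prior i.1 i.2
  round_law : ∀ (h : ℕ) (C : Set ((S × Fin K → E) × History S K N h)), MeasurableSet C →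
    ∀ (s : Fin N → S) (a : Fin N → Fin K) (B : Fin N → Set ℝ), (∀ n, MeasurableSet (B n)) →
      P {ω | (θ ω, past Y h ω) ∈ C ∧
          ∀ n, (Y h ω n).1 = s n ∧ (Y h ω n).2.1 = a n ∧ (Y h ω n).2.2 ∈ B n} =
        ∫⁻ ω in {ω | (θ ω, past Y h ω) ∈ C},
          ∏ n, M.stateLaw (s n) * π h (past Y h ω) (s n) (a n) *
            M.rewardLaw (s n) (a n) (θ ω (s n, a n)) (B n) ∂P

/-- Regret of playing arm `a` in state `s` of the instance `θ`; it is nonnegative. -/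
def gap [NeZero K] (M : BayesBandit S K E) (θ : S × Fin K → E) (s : S) (a : Fin K) : ℝ :=
  M.mean s (M.optArm θ s) (θ (s, M.optArm θ s)) - M.mean s a (θ (s, a))

/-- Bayesian system regret of the first `H` rounds: the expectation of the sum over rounds and
agents of the (nonnegative) regrets, as an element of `[0, ∞]`. -/
def bayesRegret [NeZero K] (M : BayesBandit S K E) {N : ℕ} {Ω : Type*} [MeasurableSpace Ω]
    (P : Measure Ω) (θ : Ω → S × Fin K → E) (Y : ℕ → Ω → Fin N → S × Fin K × ℝ) (H : ℕ) : ℝ≥0∞ :=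
  ∫⁻ ω, ENNReal.ofReal
    (∑ h ∈ Finset.range H, ∑ n, M.gap (θ ω) (Y h ω n).1 (Y h ω n).2.1) ∂P

/-! ### Rates -/

/-- The joint distribution `P_S(s) p(a | s)` of state and action. -/
def joint (M : BayesBandit S K E) (p : S → Fin K → ℝ≥0∞) (s : S) (a : Fin K) : ℝ :=
  (M.stateLaw s).toReal * (p s a).toReal

/-- `I(S; A)` when the state has law `P_S` and the action has conditional law `p`. -/
def policyInfo [Fintype S] (M : BayesBandit S K E) (p : S → Fin K → ℝ≥0∞) : ℝ :=
  mutualInfoBits (M.joint p)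

/-- `H(A)` when the state has law `P_S` and the action has conditional law `p`. -/
def actionEntropy [Fintype S] (M : BayesBandit S K E) (p : S → Fin K → ℝ≥0∞) : ℝ :=
  entropyBits fun a => ∑ s, M.joint p s a

/-- The optimal policy `π*(a | s)` of the instance `θ`, which plays `a*(s)` in state `s`. -/
def optPolicy [NeZero K] (M : BayesBandit S K E) (θ : S × Fin K → E) (s : S) (a : Fin K) : ℝ≥0∞ :=
  if M.optArm θ s = a then 1 else 0

/-- `H(A*)`: the entropy of `π*(a) = ∑ s, P_S(s) π*(a | s)` for the instance `θ`. -/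
def optEntropy [Fintype S] [NeZero K] (M : BayesBandit S K E) (θ : S × Fin K → E) : ℝ :=
  M.actionEntropy (M.optPolicy θ)

end BayesBandit

end

/-! Thompson sampling is probability matching: the weight it gives to arm `a` in state `s` is the
conditional probability, given the past, that `a` is the optimal arm. For fixed `s` and `a` these
weights are therefore a bounded martingale, and by Lévy's upward theorem they converge almost surely
to `p a`, the conditional probability of `a*(s) = a` given the whole future record
(`ae_tendsto_thompson`). It remains to show that `p a` is the indicator of `a*(s) = a` whenever `s`
has positive probability. Continuity of `x log x` then carries the limit over to entropy and mutual
information, and the two agree for the optimal policy because its action is a function of the state.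

Probability matching rests on Bayes' formula (`measure_optArm_inter`). The joint law of instance and
history has the likelihood as density with respect to the prior times some measure on histories. The
policy weights do not depend on the instance, so they are absorbed into that measure.

Sub-linear regret enters through Fatou. A round costs in conditional mean at least the gap of `a`
times the probability that all agents meet `s` and play `a`. The Cesàro means of this bound converge
to the gap times a positive power of `P_S(s) * p a`, so `p a = 0` wherever the gap is positive. The
gap may vanish at a tied arm, but tie-breaking makes it positive for every arm of index below
`a*(s)`. Hence `p a` vanishes on `a*(s) = b` for `a < b`. Conditioning gives `p a * p b = 0`, a
symmetric relation, so `p a` also vanishes on `a*(s) = b` for `a > b`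
(`ae_condExp_indicator_eq_ite`). -/

namespace MeasureTheory

/-! ### Integrals, densities and uniqueness on finite products. -/

theorem lintegral_fin_prod_eq_prod {n : ℕ} {X : Fin n → Type*}
    {mX : ∀ i, MeasurableSpace (X i)} {μ : (i : Fin n) → Measure (X i)} [∀ i, SigmaFinite (μ i)]
    {f : (i : Fin n) → X i → ℝ≥0∞} (hf : ∀ i, Measurable (f i)) :
    ∫⁻ x : (i : Fin n) → X i, ∏ i, f i (x i) ∂(Measure.pi μ) = ∏ i, ∫⁻ x, f i x ∂(μ i) := by
  induction n with
  | zero => simp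
  | succ n ih =>
    rw [← ((measurePreserving_piFinSuccAbove μ 0).symm).lintegral_comp_emb
      (MeasurableEquiv.measurableEmbedding _)]
    simp_rw [MeasurableEquiv.piFinSuccAbove_symm_apply, Fin.insertNthEquiv,
      Fin.prod_univ_succ, Fin.insertNth_zero, Equiv.coe_fn_mk, Fin.cons_succ,
      Fin.zero_succAbove, Fin.cons_zero]
    rw [← ih fun i => hf i.succ]
    exact lintegral_prod_mul (μ := μ 0) (ν := Measure.pi fun i : Fin n => μ i.succ)
      (f := f 0) (g := fun x => ∏ i : Fin n, f i.succ (x i)) (hf 0).aemeasurable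
      (Finset.measurable_prod _ fun i _ =>
        (hf i.succ).comp (measurable_pi_apply i)).aemeasurable

theorem lintegral_fintype_prod_eq_prod {ι : Type*} [Fintype ι] {X : ι → Type*}
    {mX : ∀ i, MeasurableSpace (X i)} {μ : (i : ι) → Measure (X i)} [∀ i, SigmaFinite (μ i)]
    {f : (i : ι) → X i → ℝ≥0∞} (hf : ∀ i, Measurable (f i)) :
    ∫⁻ x : (i : ι) → X i, ∏ i, f i (x i) ∂(Measure.pi μ) = ∏ i, ∫⁻ x, f i x ∂(μ i) := by
  let e := (Fintype.equivFin ι).symm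
  rw [← (measurePreserving_piCongrLeft _ e).lintegral_comp_emb
    (MeasurableEquiv.measurableEmbedding _)]
  simp_rw [← e.prod_comp, MeasurableEquiv.coe_piCongrLeft, Equiv.piCongrLeft_apply_apply]
  exact lintegral_fin_prod_eq_prod fun i => hf (e i)

theorem Measure.pi_withDensity {ι : Type*} [Fintype ι] {X : ι → Type*}
    {mX : ∀ i, MeasurableSpace (X i)} {μ : (i : ι) → Measure (X i)} [∀ i, SigmaFinite (μ i)]
    {f : (i : ι) → X i → ℝ≥0∞} (hf : ∀ i, Measurable (f i))
    [∀ i, SigmaFinite ((μ i).withDensity (f i))] :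
    Measure.pi (fun i => (μ i).withDensity (f i)) =
      (Measure.pi μ).withDensity fun x => ∏ i, f i (x i) := by
  refine (Measure.pi_eq fun B hB => ?_)
  rw [withDensity_apply _ (MeasurableSet.univ_pi hB), ← lintegral_indicator
    (MeasurableSet.univ_pi hB)]
  have : (Set.univ.pi B).indicator (fun x => ∏ i, f i (x i)) =
      fun x => ∏ i, (B i).indicator (f i) (x i) := by
    ext x
    by_cases hx : x ∈ Set.univ.pi B
    · rw [Set.indicator_of_mem hx]
      exact Finset.prod_congr rfl fun i _ => (Set.indicator_of_mem (hx i trivial) _).symm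
    · rw [Set.indicator_of_notMem hx]
      obtain ⟨i, hi⟩ : ∃ i, x i ∉ B i := by simpa [Set.mem_pi] using hx
      exact (Finset.prod_eq_zero (Finset.mem_univ i) (Set.indicator_of_notMem hi _)).symm
  rw [this, lintegral_fintype_prod_eq_prod fun i => (hf i).indicator (hB i)]
  exact Finset.prod_congr rfl fun i _ => by
    rw [lintegral_indicator (hB i), withDensity_apply _ (hB i)]

/-- Finite measures on `X × (ι → Z)` agreeing on measurable boxes are equal. -/
theorem Measure.ext_prod_pi {X ι Z : Type*} [Finite ι] [MeasurableSpace X] [MeasurableSpace Z]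
    {μ ν : Measure (X × (ι → Z))} [IsFiniteMeasure μ]
    (h : ∀ (C : Set X) (B : ι → Set Z), MeasurableSet C → (∀ i, MeasurableSet (B i)) →
      μ (C ×ˢ Set.univ.pi B) = ν (C ×ˢ Set.univ.pi B)) : μ = ν := by
  refine Measure.ext_prod fun {C D} hC hD => ?_
  -- With `C` fixed, both sides are finite measures in the second variable, so agreement on the
  -- π-system of boxes suffices.
  have key : (μ.restrict (C ×ˢ Set.univ)).map Prod.snd =
      (ν.restrict (C ×ˢ Set.univ)).map Prod.snd := by
    have happ : ∀ (ρ : Measure (X × (ι → Z))) (D : Set (ι → Z)), MeasurableSet D →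
        (ρ.restrict (C ×ˢ Set.univ)).map Prod.snd D = ρ (C ×ˢ D) := by
      intro ρ D hD
      rw [Measure.map_apply measurable_snd hD, Measure.restrict_apply (measurable_snd hD)]
      congr 1
      ext x
      simp [and_comm]
    refine ext_of_generate_finite _ generateFrom_pi.symm isPiSystem_pi ?_ ?_
    · rintro _ ⟨B, hB, rfl⟩
      have hB' : ∀ i, MeasurableSet (B i) := fun i => hB i trivial
      rw [happ _ _ (MeasurableSet.univ_pi hB'), happ _ _ (MeasurableSet.univ_pi hB'), h C B hC hB']
    · have := h C (fun _ => Set.univ) hC fun _ => .univ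
      rw [happ _ _ .univ, happ _ _ .univ]
      simpa using this
  have := congrArg (fun ρ => ρ D) key
  simp only [Measure.map_apply measurable_snd hD, Measure.restrict_apply (measurable_snd hD)] at this
  have hset : Prod.snd ⁻¹' D ∩ C ×ˢ (Set.univ : Set (ι → Z)) = C ×ˢ D := by
    ext x
    simp [and_comm]
  rwa [hset] at this

end MeasureTheory

/-! ### Continuity of entropy and mutual information. -/

/-- The form I = H(S) + H(A) - H(S, A) involves only terms `x log x`, which are continuous at 0,
unlike the logarithm of a quotient. -/
theorem mutualInfoBits_eq {α β : Type*} [Fintype α] [Fintype β] {q : α → β → ℝ}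
    (hq : ∀ s a, 0 ≤ q s a) :
    mutualInfoBits q = entropyBits (fun s => ∑ a, q s a) + entropyBits (fun a => ∑ s, q s a)
      + ∑ s, ∑ a, q s a * Real.logb 2 (q s a) := by
  have hterm : ∀ s a, q s a * Real.logb 2 (q s a / ((∑ b, q s b) * (∑ t, q t a))) =
      q s a * Real.logb 2 (q s a) - q s a * Real.logb 2 (∑ b, q s b)
        - q s a * Real.logb 2 (∑ t, q t a) := by
    intro s a
    rcases (hq s a).eq_or_lt with h | h
    · simp [← h]
    · have h1 : 0 < ∑ b, q s b :=
        h.trans_le (Finset.single_le_sum (f := fun b => q s b) (fun b _ => hq s b)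
          (Finset.mem_univ a))
      have h2 : 0 < ∑ t, q t a :=
        h.trans_le (Finset.single_le_sum (f := fun t => q t a) (fun t _ => hq t a)
          (Finset.mem_univ s))
      rw [Real.logb_div h.ne' (mul_pos h1 h2).ne', Real.logb_mul h1.ne' h2.ne']
      ring
  simp only [mutualInfoBits, hterm, Finset.sum_sub_distrib, entropyBits]
  rw [Finset.sum_comm (f := fun s a => q s a * Real.logb 2 (∑ t, q t a))]
  simp only [← Finset.sum_mul]
  ring

theorem continuous_mul_logb (b : ℝ) : Continuous fun x : ℝ => x * Real.logb b x := by
  have : (fun x : ℝ => x * Real.logb b x) = fun x => x * Real.log x / Real.log b := by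
    ext x
    rw [Real.logb, mul_div_assoc]
  rw [this]
  exact Real.continuous_mul_log.div_const _

theorem continuous_entropyBits {α : Type*} [Fintype α] :
    Continuous (entropyBits : (α → ℝ) → ℝ) :=
  (continuous_finsetSum _ fun a _ =>
    (continuous_mul_logb 2).comp (continuous_apply a)).neg

theorem continuous_entropyBits_sum {α β : Type*} [Fintype α] [Fintype β] :
    Continuous fun q : α → β → ℝ => entropyBits fun a => ∑ s, q s a :=
  continuous_entropyBits.comp (continuous_pi fun a => continuous_finsetSum _ fun s _ =>
    (continuous_apply a).comp (continuous_apply s))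

theorem tendsto_mutualInfoBits {α β ι : Type*} [Fintype α] [Fintype β] {l : Filter ι}
    {q : ι → α → β → ℝ} {r : α → β → ℝ} (hq : ∀ i s a, 0 ≤ q i s a) (hr : ∀ s a, 0 ≤ r s a)
    (h : Tendsto q l (𝓝 r)) :
    Tendsto (fun i => mutualInfoBits (q i)) l (𝓝 (mutualInfoBits r)) := by
  simp only [mutualInfoBits_eq (hq _), mutualInfoBits_eq hr]
  have hc : Continuous fun q : α → β → ℝ => entropyBits (fun s => ∑ a, q s a) +
      entropyBits (fun a => ∑ s, q s a) + ∑ s, ∑ a, q s a * Real.logb 2 (q s a) := by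
    have hap (s : α) (a : β) : Continuous fun q : α → β → ℝ => q s a :=
      (continuous_apply a).comp (continuous_apply s)
    refine ((continuous_entropyBits.comp ?_).add (continuous_entropyBits.comp ?_)).add ?_
    · exact continuous_pi fun s => continuous_finsetSum _ fun a _ => hap s a
    · exact continuous_pi fun a => continuous_finsetSum _ fun s _ => hap s a
    · exact continuous_finsetSum _ fun s _ => continuous_finsetSum _ fun a _ =>
        (continuous_mul_logb 2).comp (hap s a)
  exact (hc.tendsto r).comp h

/-! ### The optimal arm as a measurable function of the means. -/

theorem mem_maximizers {K : ℕ} {m : Fin K → ℝ} {a : Fin K} :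
    a ∈ maximizers m ↔ ∀ b, m b ≤ m a := by
  simp [maximizers]

theorem bestArm_mem {K : ℕ} [NeZero K] (m : Fin K → ℝ) : bestArm m ∈ maximizers m :=
  Finset.min'_mem _ _

theorem bestArm_eq_iff {K : ℕ} [NeZero K] {m : Fin K → ℝ} {a : Fin K} :
    bestArm m = a ↔ (∀ b, m b ≤ m a) ∧ ∀ c < a, ¬ ∀ b, m b ≤ m c := by
  constructor
  · rintro rfl
    exact ⟨mem_maximizers.1 (bestArm_mem m), fun c hc h =>
      (Finset.min'_le _ _ (mem_maximizers.2 h)).not_gt hc⟩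
  · rintro ⟨h1, h2⟩
    refine le_antisymm (Finset.min'_le _ _ (mem_maximizers.2 h1)) ?_
    by_contra! hlt
    exact h2 _ hlt (mem_maximizers.1 (bestArm_mem m))

theorem measurable_bestArm {K : ℕ} [NeZero K] :
    Measurable (bestArm : (Fin K → ℝ) → Fin K) := by
  refine measurable_to_countable' fun a => ?_
  have : bestArm ⁻¹' {a} =
      {m : Fin K → ℝ | (∀ b, m b ≤ m a) ∧ ∀ c, c < a → ¬ ∀ b, m b ≤ m c} := by
    ext m
    exact bestArm_eq_iff
  rw [this]
  have hmax (c : Fin K) : MeasurableSet {m : Fin K → ℝ | ∀ b, m b ≤ m c} :=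
    measurableSet_setOfPred.2 <| .forall fun b => measurableSet_setOfPred.1 <|
      measurableSet_le (measurable_pi_apply b) (measurable_pi_apply c)
  exact (hmax a).inter <| measurableSet_setOfPred.2 <| .forall fun c => .forall fun _ =>
    (measurableSet_setOfPred.1 (hmax c)).not

/-! ### Gaps, posteriors and their measurability. -/

namespace BayesBandit

attribute [instance] BayesBandit.isProbabilityMeasure_prior BayesBandit.sigmaFinite_ref

variable {S : Type*} {K : ℕ} {E : Type*} [MeasurableSpace E] (M : BayesBandit S K E)

theorem measurable_density_apply (s : S) (a : Fin K) (e : E) : Measurable (M.density s a e) :=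
  (M.measurable_density s a).comp measurable_prodMk_left

instance isProbabilityMeasure_rewardLaw (s : S) (a : Fin K) (e : E) :
    IsProbabilityMeasure (M.rewardLaw s a e) :=
  ⟨by rw [rewardLaw, withDensity_apply _ .univ, setLIntegral_univ, M.lintegral_density]⟩

theorem measurable_mean (s : S) (a : Fin K) : Measurable (M.mean s a) := by
  have h : ∀ e, M.mean s a e = ∫ r, (M.density s a e r).toReal * r ∂M.ref := by
    intro e
    rw [mean, rewardLaw, integral_withDensity_eq_integral_toReal_smul
      (M.measurable_density_apply s a e)]
    · rfl
    · exact ae_lt_top (M.measurable_density_apply s a e) (by simp [M.lintegral_density])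
  simp_rw [funext h]
  exact (StronglyMeasurable.integral_prod_right
    (f := fun e r => (M.density s a e r).toReal * r)
    ((M.measurable_density s a).ennreal_toReal.mul measurable_snd).stronglyMeasurable).measurable

theorem measurable_means (s : S) :
    Measurable fun (e : Fin K → E) (b : Fin K) => M.mean s b (e b) :=
  measurable_pi_lambda _ fun b => (M.measurable_mean s b).comp (measurable_pi_apply b)

theorem measurableSet_bestArm_mean [NeZero K] (s : S) (a : Fin K) :
    MeasurableSet {e : Fin K → E | bestArm (fun b => M.mean s b (e b)) = a} :=
  (measurable_bestArm.comp (M.measurable_means s)) (measurableSet_singleton a)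

theorem measurable_optArm [NeZero K] (s : S) :
    Measurable fun θ : S × Fin K → E => M.optArm θ s :=
  measurable_bestArm.comp (measurable_pi_lambda _ fun a =>
    (M.measurable_mean s a).comp (measurable_pi_apply (s, a)))

theorem measurableSet_optArm [NeZero K] (s : S) (a : Fin K) :
    MeasurableSet {t : S × Fin K → E | M.optArm t s = a} :=
  M.measurable_optArm s (measurableSet_singleton a)

theorem measurable_gap [NeZero K] (s : S) (a : Fin K) :
    Measurable fun θ : S × Fin K → E => M.gap θ s a := by
  have h : ∀ b, Measurable fun θ : S × Fin K → E => M.mean s b (θ (s, b)) := fun b =>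
    (M.measurable_mean s b).comp (measurable_pi_apply (s, b))
  exact ((measurable_from_prod_countable_right
    (f := fun p : Fin K × (S × Fin K → E) => M.mean s p.1 (p.2 (s, p.1))) h).comp
    ((M.measurable_optArm s).prodMk measurable_id)).sub (h a)

theorem gap_nonneg [NeZero K] (θ : S × Fin K → E) (s : S) (a : Fin K) : 0 ≤ M.gap θ s a :=
  sub_nonneg.2 ((bestArm_eq_iff (m := fun a => M.mean s a (θ (s, a)))).1 rfl |>.1 a)

/-- An arm of smaller index cannot tie with the optimal arm, since it would have been chosen
instead. Arms of larger index can tie, so no such bound holds for them. -/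
theorem gap_pos_of_lt_optArm [NeZero K] {θ : S × Fin K → E} {s : S} {a : Fin K}
    (h : a < M.optArm θ s) : 0 < M.gap θ s a := by
  obtain ⟨b, hb⟩ : ∃ b, M.mean s a (θ (s, a)) < M.mean s b (θ (s, b)) := by
    simpa using (bestArm_eq_iff (m := fun a => M.mean s a (θ (s, a)))).1 rfl |>.2 a h
  exact sub_pos.2 (hb.trans_le
    ((bestArm_eq_iff (m := fun a => M.mean s a (θ (s, a)))).1 rfl |>.1 b))

section Posterior

variable {N h : ℕ}

instance isProbabilityMeasure_posterior (x : History S K N h) (s : S) (a : Fin K) :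
    IsProbabilityMeasure (M.posterior x s a) := by
  unfold posterior
  split_ifs with hx
  · infer_instance
  · rw [not_or] at hx
    refine ⟨?_⟩
    rw [Measure.smul_apply, withDensity_apply _ .univ, setLIntegral_univ, smul_eq_mul]
    exact ENNReal.inv_mul_cancel hx.1 hx.2

/-- Sampling means is the image of sampling parameters, which moves the question to the space where
Bayes' formula lives. -/
theorem thompson_eq_pi_posterior [NeZero K] (x : History S K N h) (s : S) (a : Fin K) :
    M.thompson N h x s a = Measure.pi (fun b => M.posterior x s b)
      {e | bestArm (fun b => M.mean s b (e b)) = a} := by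
  have (b : Fin K) : IsProbabilityMeasure ((M.posterior x s b).map (M.mean s b)) :=
    Measure.isProbabilityMeasure_map (M.measurable_mean s b).aemeasurable
  rw [thompson]
  simp only [meanPosterior]
  rw [← Measure.pi_map_pi fun b => (M.measurable_mean s b).aemeasurable,
    Measure.map_apply (M.measurable_means s)
      (measurableSet_eq_fun measurable_bestArm measurable_const)]
  rfl

theorem thompson_le_one [NeZero K] (x : History S K N h) (s : S) (a : Fin K) :
    M.thompson N h x s a ≤ 1 := by
  rw [thompson_eq_pi_posterior]
  exact prob_le_one

variable [MeasurableSpace S] [MeasurableSingletonClass S]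

theorem measurable_likelihood (s : S) (a : Fin K) :
    Measurable fun p : History S K N h × E => M.likelihood p.1 s a p.2 := by
  refine Finset.measurable_prod _ fun i _ => Finset.measurable_prod _ fun n _ => ?_
  have hx : Measurable fun p : History S K N h × E => p.1 i n :=
    measurable_pi_iff.1 (measurable_pi_iff.1 measurable_fst i) n
  refine Measurable.ite ?_ ?_ measurable_const
  · exact (hx.fst (measurableSet_singleton s)).inter (hx.snd.fst (measurableSet_singleton a))
  · exact (M.measurable_density s a).comp (measurable_snd.prodMk hx.snd.snd)

theorem measurable_likelihood_apply (x : History S K N h) (s : S) (a : Fin K) :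
    Measurable (M.likelihood x s a) := by
  have := (M.measurable_likelihood (N := N) (h := h) s a).comp (measurable_prodMk_left (x := x))
  exact this

theorem measurable_evidence (s : S) (a : Fin K) :
    Measurable fun x : History S K N h => M.evidence x s a :=
  (M.measurable_likelihood s a).lintegral_prod_right'

theorem measurable_posterior (s : S) (a : Fin K) :
    Measurable fun x : History S K N h => M.posterior x s a := by
  refine Measurable.ite ?_ measurable_const ?_
  · exact (M.measurable_evidence s a (measurableSet_singleton 0)).union
      (M.measurable_evidence s a (measurableSet_singleton ∞))
  · refine Measure.measurable_of_measurable_coe _ fun B hB => ?_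
    simp only [Measure.smul_apply, smul_eq_mul, withDensity_apply _ hB]
    exact (M.measurable_evidence s a).inv.mul (M.measurable_likelihood s a).lintegral_prod_right'

theorem measurable_thompson [NeZero K] (s : S) (a : Fin K) :
    Measurable fun x : History S K N h => M.thompson N h x s a := by
  have : Measurable fun x : History S K N h => Measure.pi fun b => M.posterior x s b := by
    refine Measurable.measure_of_isPiSystem_of_isProbabilityMeasure generateFrom_pi.symm
      isPiSystem_pi ?_
    rintro _ ⟨B, hB, rfl⟩
    simp only [Measure.pi_pi]
    exact Finset.measurable_prod _ fun b _ =>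
      (Measure.measurable_coe (hB b trivial)).comp (M.measurable_posterior s b)
  simp only [thompson_eq_pi_posterior]
  exact (Measure.measurable_coe (M.measurableSet_bestArm_mean s a)).comp this

end Posterior

end BayesBandit

/-! ### The law of one round. -/

namespace BayesBandit

variable {S : Type*} {K : ℕ} {E : Type*} [MeasurableSpace E] (M : BayesBandit S K E)
variable [Fintype S] [MeasurableSpace S] {N : ℕ} {π : Policy S K N}
  {Ω : Type*} [MeasurableSpace Ω] {P : Measure Ω}
  {θ : Ω → S × Fin K → E} {Y : ℕ → Ω → Fin N → S × Fin K × ℝ}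

section Round

variable {M}

theorem IsInteraction.measurable_past (hI : M.IsInteraction π P θ Y) (h : ℕ) :
    Measurable (past Y h) :=
  measurable_pi_lambda _ fun i => hI.measurable_obs i

variable [MeasurableSingletonClass S]

theorem IsInteraction.measurableSet_round (hI : M.IsInteraction π P θ Y) (h : ℕ)
    (s : Fin N → S) (a : Fin N → Fin K) :
    MeasurableSet {ω | ∀ n, (Y h ω n).1 = s n ∧ (Y h ω n).2.1 = a n} := by
  have hn (n : Fin N) : Measurable fun ω => Y h ω n :=
    measurable_pi_iff.1 (hI.measurable_obs h) n
  exact measurableSet_setOfPred.2 <| .forall fun n => measurableSet_setOfPred.1 <|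
    ((hn n).fst (measurableSet_singleton (s n))).inter
      ((hn n).snd.fst (measurableSet_singleton (a n)))

/-- Integrals over the event that the agents meet states `s` and take actions `a` in round `h`. -/
theorem IsInteraction.setLIntegral_round [IsFiniteMeasure P] (hI : M.IsInteraction π P θ Y)
    {h : ℕ} (hπ : ∀ s a, Measurable fun x => π h x s a) (s : Fin N → S) (a : Fin N → Fin K)
    {f : ((S × Fin K → E) × History S K N h) × (Fin N → ℝ) → ℝ≥0∞} (hf : Measurable f) :
    ∫⁻ ω in {ω | ∀ n, (Y h ω n).1 = s n ∧ (Y h ω n).2.1 = a n},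
        f ((θ ω, past Y h ω), fun n => (Y h ω n).2.2) ∂P =
      ∫⁻ ω, ∫⁻ r, f ((θ ω, past Y h ω), r) *
        ∏ n, (M.stateLaw (s n) * π h (past Y h ω) (s n) (a n) *
          M.density (s n) (a n) (θ ω (s n, a n)) (r n)) ∂(Measure.pi fun _ => M.ref) ∂P := by
  set A := {ω | ∀ n, (Y h ω n).1 = s n ∧ (Y h ω n).2.1 = a n} with hA
  have hAm : MeasurableSet A := hI.measurableSet_round h s a
  have hX : Measurable fun ω => (θ ω, past Y h ω) :=
    hI.measurable_instance.prodMk (hI.measurable_past h)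
  have hR : Measurable fun ω n => (Y h ω n).2.2 := measurable_pi_lambda _ fun n =>
    (measurable_pi_iff.1 (hI.measurable_obs h) n).snd.snd
  have hd (n : Fin N) : Measurable fun z : ((S × Fin K → E) × History S K N h) × (Fin N → ℝ) =>
      M.stateLaw (s n) * π h z.1.2 (s n) (a n) *
        M.density (s n) (a n) (z.1.1 (s n, a n)) (z.2 n) := by
    refine ((hπ (s n) (a n)).comp measurable_fst.snd).const_mul _ |>.mul ?_
    have ht : Measurable fun z : ((S × Fin K → E) × History S K N h) × (Fin N → ℝ) =>
        (z.1.1 (s n, a n), z.2 n) :=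
      (measurable_pi_iff.1 measurable_fst.fst (s n, a n)).prodMk
        (measurable_pi_iff.1 measurable_snd n)
    exact (M.measurable_density (s n) (a n)).comp ht
  set w : ((S × Fin K → E) × History S K N h) × (Fin N → ℝ) → ℝ≥0∞ := fun z =>
    ∏ n, (M.stateLaw (s n) * π h z.1.2 (s n) (a n) *
        M.density (s n) (a n) (z.1.1 (s n, a n)) (z.2 n)) with hw
  have hwm : Measurable w := Finset.measurable_prod _ fun n _ => hd n
  -- On boxes this is the defining law of a round combined with Tonelli; boxes determine the
  -- measure.
  have key : (P.restrict A).map (fun ω => ((θ ω, past Y h ω), fun n => (Y h ω n).2.2)) =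
      ((P.map fun ω => (θ ω, past Y h ω)).prod (Measure.pi fun _ => M.ref)).withDensity w := by
    refine Measure.ext_prod_pi fun C B hC hB => ?_
    have hCB := hC.prod (MeasurableSet.univ_pi hB)
    rw [Measure.map_apply (hX.prodMk hR) hCB, Measure.restrict_apply ((hX.prodMk hR) hCB),
      withDensity_apply _ hCB, ← Measure.prod_restrict, lintegral_prod _ hwm.aemeasurable,
      setLIntegral_map hC hwm.lintegral_prod_right' hX, Measure.restrict_pi_pi]
    have := hI.round_law h C hC s a B hB
    refine Eq.trans (congrArg P ?_) (this.trans (lintegral_congr fun ω => ?_))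
    · ext ω
      simp only [hA, Set.mem_inter_iff, Set.mem_preimage, Set.mem_prod, Set.mem_pi, Set.mem_univ,
        forall_true_left, Set.mem_ofPred_eq]
      constructor
      · rintro ⟨⟨h1, h2⟩, h3⟩
        exact ⟨h1, fun n => ⟨(h3 n).1, (h3 n).2, h2 n⟩⟩
      · rintro ⟨h1, h2⟩
        exact ⟨⟨h1, fun n => (h2 n).2.2⟩, fun n => ⟨(h2 n).1, (h2 n).2.1⟩⟩
    · simp only [hw]
      rw [lintegral_fintype_prod_eq_prod (f := fun n r => M.stateLaw (s n) *
        π h (past Y h ω) (s n) (a n) * M.density (s n) (a n) (θ ω (s n, a n)) r)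
        fun n => (M.measurable_density_apply _ _ _).const_mul _]
      refine Finset.prod_congr rfl fun n _ => ?_
      rw [lintegral_const_mul _ (M.measurable_density_apply _ _ _), rewardLaw,
        withDensity_apply _ (hB n)]
  have := congrArg (fun ρ => ∫⁻ z, f z ∂ρ) key
  simp only [lintegral_map hf (hX.prodMk hR), lintegral_withDensity_eq_lintegral_mul _ hwm hf] at this
  rw [this, lintegral_prod _ (hwm.mul hf).aemeasurable,
    lintegral_map (hwm.mul hf).lintegral_prod_right' hX]
  simp only [Pi.mul_apply, hw, mul_comm]

/-- Integrals over the event that all agents meet state `s` and take action `a` in round `h`. -/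
theorem IsInteraction.setLIntegral_round_const [IsFiniteMeasure P] (hI : M.IsInteraction π P θ Y)
    {h : ℕ} (hπ : ∀ s a, Measurable fun x => π h x s a) (s : S) (a : Fin K)
    {f : (S × Fin K → E) → ℝ≥0∞} (hf : Measurable f) :
    ∫⁻ ω in {ω | ∀ n, (Y h ω n).1 = s ∧ (Y h ω n).2.1 = a}, f (θ ω) ∂P =
      ∫⁻ ω, f (θ ω) * (M.stateLaw s * π h (past Y h ω) s a) ^ N ∂P := by
  rw [hI.setLIntegral_round hπ (fun _ => s) (fun _ => a) (f := fun z => f z.1.1)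
    (hf.comp measurable_fst.fst)]
  refine lintegral_congr fun ω => ?_
  have hd := (M.measurable_density_apply s a (θ ω (s, a))).const_mul
    (M.stateLaw s * π h (past Y h ω) s a)
  rw [lintegral_const_mul (f (θ ω)) (f := fun r : Fin N → ℝ => ∏ n, (M.stateLaw s *
      π h (past Y h ω) s a * M.density s a (θ ω (s, a)) (r n)))
      (Finset.measurable_prod _ fun n _ => hd.comp (measurable_pi_apply n)),
    lintegral_fintype_prod_eq_prod (f := fun _ r => M.stateLaw s * π h (past Y h ω) s a *
      M.density s a (θ ω (s, a)) r) fun _ => hd,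
    lintegral_const_mul _ (M.measurable_density_apply _ _ _), M.lintegral_density]
  simp

end Round

end BayesBandit

/-! ### The likelihood as density of instance and history. -/

noncomputable section

/-- Append the observations of one more round to a history. -/
def History.append {S : Type*} {K N h : ℕ} (x : History S K N h) (y : Fin N → S × Fin K × ℝ) :
    History S K N (h + 1) :=
  Fin.snoc (α := fun _ => Fin N → S × Fin K × ℝ) x y

theorem History.measurable_append {S : Type*} [MeasurableSpace S] {K N h : ℕ} :
    Measurable fun p : History S K N h × (Fin N → S × Fin K × ℝ) => History.append p.1 p.2 := by
  refine measurable_pi_lambda _ fun i => ?_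
  refine Fin.lastCases ?_ (fun j => ?_) i
  · simpa only [History.append, Fin.snoc_last] using measurable_snd
  · simpa only [History.append, Fin.snoc_castSucc] using measurable_pi_iff.1 measurable_fst j

namespace BayesBandit

variable {S : Type*} {K : ℕ} {E : Type*} [MeasurableSpace E] (M : BayesBandit S K E)

theorem past_succ {Ω : Type*} {N : ℕ} (Y : ℕ → Ω → Fin N → S × Fin K × ℝ) (h : ℕ) (ω : Ω) :
    past Y (h + 1) ω = History.append (past Y h ω) (Y h ω) := by
  ext1 i
  refine Fin.lastCases ?_ (fun j => ?_) i
  · simp [past, History.append]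
  · simp [past, History.append]

open Classical in
theorem likelihood_append {N h : ℕ} (x : History S K N h) (s' : Fin N → S) (a' : Fin N → Fin K)
    (r : Fin N → ℝ) (s : S) (a : Fin K) (e : E) :
    M.likelihood (x.append fun n => (s' n, a' n, r n)) s a e = M.likelihood x s a e *
      ∏ n, if (s, a) = (s' n, a' n) then M.density s a e (r n) else 1 := by
  simp only [likelihood, Fin.prod_univ_castSucc, History.append, Fin.snoc_castSucc, Fin.snoc_last,
    Prod.mk.injEq]
  refine congrArg₂ _ rfl (Finset.prod_congr rfl fun n _ => ?_)
  exact if_congr (by rw [eq_comm (a := s), eq_comm (a := a)]) rfl rfl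

variable [Fintype S]

/-- The prior distribution of an instance. -/
abbrev instancePrior : Measure (S × Fin K → E) :=
  Measure.pi fun i : S × Fin K => M.prior i.1 i.2

/-- Likelihood of the instance `t`. -/
def instanceLikelihood {N h : ℕ} (x : History S K N h) (t : S × Fin K → E) : ℝ≥0∞ :=
  ∏ i : S × Fin K, M.likelihood x i.1 i.2 (t i)

theorem instanceLikelihood_append {N h : ℕ} (x : History S K N h) (s : Fin N → S)
    (a : Fin N → Fin K) (r : Fin N → ℝ) (t : S × Fin K → E) :
    M.instanceLikelihood (x.append fun n => (s n, a n, r n)) t =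
      M.instanceLikelihood x t * ∏ n, M.density (s n) (a n) (t (s n, a n)) (r n) := by
  classical
  simp only [instanceLikelihood, likelihood_append, Finset.prod_mul_distrib]
  congr 1
  rw [Finset.prod_comm]
  refine Finset.prod_congr rfl fun n _ => ?_
  rw [Finset.prod_ite_eq']
  simp

variable [MeasurableSpace S] [MeasurableSingletonClass S] {N : ℕ}

theorem measurable_instanceLikelihood {h : ℕ} :
    Measurable fun p : History S K N h × (S × Fin K → E) => M.instanceLikelihood p.1 p.2 := by
  refine Finset.measurable_prod _ fun i _ => ?_
  have hi : Measurable fun p : History S K N h × (S × Fin K → E) => (p.1, p.2 i) :=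
    measurable_fst.prodMk (measurable_pi_iff.1 measurable_snd i)
  have := (M.measurable_likelihood (N := N) (h := h) i.1 i.2).comp hi
  exact this

variable {M} {π : Policy S K N}
  {Ω : Type*} [MeasurableSpace Ω] {P : Measure Ω}
  {θ : Ω → S × Fin K → E} {Y : ℕ → Ω → Fin N → S × Fin K × ℝ}

/-- The joint law of the instance and the history has, with respect to the product of the prior and
some measure on histories, the likelihood as a density. -/
theorem IsInteraction.exists_lintegral_eq [IsProbabilityMeasure P]
    (hI : M.IsInteraction π P θ Y)
    (hπ : ∀ h s a, Measurable fun x => π h x s a) (h : ℕ) :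
    ∃ Λ : Measure (History S K N h), SFinite Λ ∧
      ∀ f : (S × Fin K → E) × History S K N h → ℝ≥0∞, Measurable f →
        ∫⁻ ω, f (θ ω, past Y h ω) ∂P =
          ∫⁻ x, ∫⁻ t, f (t, x) * M.instanceLikelihood x t ∂M.instancePrior ∂Λ := by
  induction h with
  | zero =>
    -- Before any round there is only one history, and the likelihood is an empty product.
    refine ⟨Measure.dirac default, inferInstance, fun f hf => ?_⟩
    rw [lintegral_dirac]
    have h1 : ∀ t, M.instanceLikelihood (default : History S K N 0) t = 1 := fun t => by
      simp [instanceLikelihood, likelihood]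
    have hft : Measurable fun t => f (t, (default : History S K N 0)) :=
      hf.comp measurable_prodMk_right
    simp only [h1, mul_one]
    rw [instancePrior, ← hI.instance_law, lintegral_map hft hI.measurable_instance]
    exact lintegral_congr fun ω => by rw [Subsingleton.elim (past Y 0 ω) default]
  | succ h ih =>
    obtain ⟨Λ, hΛ, ih⟩ := ih
    let w : (Fin N → S) × (Fin N → Fin K) → History S K N h → ℝ≥0∞ := fun p x =>
      ∏ n, (M.stateLaw (p.1 n) * π h x (p.1 n) (p.2 n))
    have hw (p) : Measurable (w p) := Finset.measurable_prod _ fun n _ => (hπ h _ _).const_mul _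
    let g : (Fin N → S) × (Fin N → Fin K) → History S K N h × (Fin N → ℝ) →
      History S K N (h + 1) := fun p z => z.1.append fun n => (p.1 n, p.2 n, z.2 n)
    have hg (p) : Measurable (g p) := by
      have : Measurable fun z : History S K N h × (Fin N → ℝ) =>
          (z.1, fun n => (p.1 n, p.2 n, z.2 n)) :=
        measurable_fst.prodMk <| measurable_pi_lambda _ fun n =>
          measurable_const.prodMk (measurable_const.prodMk (measurable_pi_iff.1 measurable_snd n))
      exact History.measurable_append.comp this
    -- The weights `w p` of states and actions depend on the history alone, so they join the measure
    -- on histories; only the reward densities enter the likelihood. The sum runs over the finitely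
    -- many state-action patterns of the new round.
    refine ⟨Measure.sum fun p => ((Λ.withDensity (w p)).prod (Measure.pi fun _ => M.ref)).map (g p),
      inferInstance, fun f hf => ?_⟩
    have hfL : Measurable fun z : History S K N (h + 1) × (S × Fin K → E) =>
        f (z.2, z.1) * M.instanceLikelihood z.1 z.2 :=
      (hf.comp measurable_swap).mul M.measurable_instanceLikelihood
    rw [lintegral_sum_measure, tsum_fintype]
    let A : (Fin N → S) × (Fin N → Fin K) → Set Ω := fun p =>
      {ω | ∀ n, (Y h ω n).1 = p.1 n ∧ (Y h ω n).2.1 = p.2 n}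
    have hA (p) : MeasurableSet (A p) := hI.measurableSet_round h p.1 p.2
    have hU : ⋃ p, A p = Set.univ := Set.eq_univ_of_forall fun ω => Set.mem_iUnion.2
      ⟨(fun n => (Y h ω n).1, fun n => (Y h ω n).2.1), fun n => ⟨rfl, rfl⟩⟩
    have hdisj : Pairwise (Function.onFun Disjoint A) := fun p q hpq =>
      Set.disjoint_left.2 fun ω hp hq => hpq <| Prod.ext
        (funext fun n => (hp n).1.symm.trans (hq n).1) (funext fun n => (hp n).2.symm.trans (hq n).2)
    rw [← setLIntegral_univ, ← hU, lintegral_iUnion hA hdisj, tsum_fintype]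
    refine Finset.sum_congr rfl fun p _ => ?_
    have hfg : Measurable fun z : ((S × Fin K → E) × History S K N h) × (Fin N → ℝ) =>
        f (z.1.1, g p (z.1.2, z.2)) :=
      hf.comp (measurable_fst.fst.prodMk
        ((hg p).comp (measurable_fst.snd.prodMk measurable_snd)))
    have hd : Measurable fun z : ((S × Fin K → E) × History S K N h) × (Fin N → ℝ) =>
        ∏ n, M.density (p.1 n) (p.2 n) (z.1.1 (p.1 n, p.2 n)) (z.2 n) := by
      refine Finset.measurable_prod _ fun n _ => ?_
      have ht : Measurable fun z : ((S × Fin K → E) × History S K N h) × (Fin N → ℝ) =>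
          (z.1.1 (p.1 n, p.2 n), z.2 n) :=
        (measurable_pi_iff.1 measurable_fst.fst (p.1 n, p.2 n)).prodMk
          (measurable_pi_iff.1 measurable_snd n)
      exact (M.measurable_density _ _).comp ht
    have hF : Measurable fun z : ((S × Fin K → E) × History S K N h) × (Fin N → ℝ) =>
        f (z.1.1, g p (z.1.2, z.2)) * (w p z.1.2 *
          ∏ n, M.density (p.1 n) (p.2 n) (z.1.1 (p.1 n, p.2 n)) (z.2 n)) :=
      hfg.mul (((hw p).comp measurable_fst.snd).mul hd)
    calc
      _ = ∫⁻ ω in A p, f (θ ω, g p (past Y h ω, fun n => (Y h ω n).2.2)) ∂P := by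
        refine setLIntegral_congr_fun (hA p) fun ω hω => ?_
        simp only [past_succ, g]
        congr 3
        funext n
        exact Prod.ext (hω n).1 (Prod.ext (hω n).2 rfl)
      _ = ∫⁻ ω, ∫⁻ r, f (θ ω, g p (past Y h ω, r)) * (w p (past Y h ω) *
            ∏ n, M.density (p.1 n) (p.2 n) (θ ω (p.1 n, p.2 n)) (r n))
              ∂(Measure.pi fun _ => M.ref) ∂P := by
        rw [hI.setLIntegral_round (hπ h) p.1 p.2 hfg]
        simp only [w, Finset.prod_mul_distrib]
      _ = ∫⁻ x, ∫⁻ t, (∫⁻ r, f (t, g p (x, r)) * (w p x *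
            ∏ n, M.density (p.1 n) (p.2 n) (t (p.1 n, p.2 n)) (r n))
              ∂(Measure.pi fun _ => M.ref)) * M.instanceLikelihood x t ∂M.instancePrior ∂Λ :=
        ih _ hF.lintegral_prod_right'
      _ = ∫⁻ x, w p x * ∫⁻ r, ∫⁻ t, f (t, g p (x, r)) * M.instanceLikelihood (g p (x, r)) t
            ∂M.instancePrior ∂(Measure.pi fun _ => M.ref) ∂Λ := by
        refine lintegral_congr fun x => ?_
        have hx : Measurable fun z : (Fin N → ℝ) × (S × Fin K → E) =>
            f (z.2, g p (x, z.1)) * M.instanceLikelihood (g p (x, z.1)) z.2 :=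
          hfL.comp (((hg p).comp (measurable_const.prodMk measurable_fst)).prodMk measurable_snd)
        rw [lintegral_lintegral_swap hx.aemeasurable, ← lintegral_const_mul]
        · refine lintegral_congr fun t => ?_
          rw [← lintegral_const_mul, ← lintegral_mul_const]
          · refine lintegral_congr fun r => ?_
            simp only [g, instanceLikelihood_append]
            ring
          · exact hF.comp (measurable_prodMk_left (x := (t, x)))
          · exact hx.comp (measurable_prodMk_right (y := t))
        · exact Measurable.lintegral_prod_left' hx
      _ = _ := by
        have hG : Measurable fun x : History S K N (h + 1) =>
            ∫⁻ t, f (t, x) * M.instanceLikelihood x t ∂M.instancePrior :=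
          hfL.lintegral_prod_right'
        have hGg : Measurable fun z : History S K N h × (Fin N → ℝ) =>
            ∫⁻ t, f (t, g p z) * M.instanceLikelihood (g p z) t ∂M.instancePrior :=
          hG.comp (hg p)
        rw [lintegral_map hG (hg p), lintegral_prod _ hGg.aemeasurable,
          lintegral_withDensity_eq_lintegral_mul _ (hw p) hGg.lintegral_prod_right']
        rfl

end BayesBandit

end

/-! ### Bayes' formula and probability matching. -/

theorem MeasureTheory.Measure.map_pi_prodMk {α β X : Type*} [Fintype α] [Fintype β]
    [MeasurableSpace X] (ρ : α → β → Measure X) [∀ s b, IsProbabilityMeasure (ρ s b)] (s : α) :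
    (Measure.pi fun i : α × β => ρ i.1 i.2).map (fun t b => t (s, b)) =
      Measure.pi fun b => ρ s b := by
  classical
  refine (Measure.pi_eq fun B hB => ?_).symm
  rw [Measure.map_apply (measurable_pi_lambda _ fun b => measurable_pi_apply (s, b))
    (MeasurableSet.univ_pi hB)]
  have : (fun (t : α × β → X) b => t (s, b)) ⁻¹' Set.univ.pi B =
      Set.univ.pi fun i => if i.1 = s then B i.2 else Set.univ := by
    ext t
    simp only [Set.mem_preimage, Set.mem_pi, Set.mem_univ, forall_true_left, Prod.forall]
    constructor
    · intro h s' b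
      split_ifs with hs
      · exact hs ▸ h b
      · trivial
    · intro h b
      simpa using h s b
  rw [this, Measure.pi_pi, Fintype.prod_prod_type, Finset.prod_eq_single s]
  · simp
  · intro s' _ hs
    simp [hs]
  · simp

namespace BayesBandit

variable {S : Type*} {K : ℕ} {E : Type*} [MeasurableSpace E] (M : BayesBandit S K E)
  {N : ℕ}

/-- A whole instance may be sampled from the posterior, as the coordinates of the other states
integrate out. -/
theorem thompson_eq_pi_optArm [Fintype S] [NeZero K] {h : ℕ} (x : History S K N h) (s : S) (a : Fin K) :
    M.thompson N h x s a =
      Measure.pi (fun i : S × Fin K => M.posterior x i.1 i.2) {t | M.optArm t s = a} := by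
  rw [thompson_eq_pi_posterior, ← Measure.map_pi_prodMk (fun s b => M.posterior x s b) s,
    Measure.map_apply (measurable_pi_lambda _ fun b => measurable_pi_apply (s, b))
      (M.measurableSet_bestArm_mean s a)]
  rfl

variable [MeasurableSpace S] [MeasurableSingletonClass S]

theorem posterior_eq_withDensity {h : ℕ} {x : History S K N h} {s : S} {a : Fin K}
    (h0 : M.evidence x s a ≠ 0) (h1 : M.evidence x s a ≠ ∞) :
    M.posterior x s a =
      (M.prior s a).withDensity fun e => (M.evidence x s a)⁻¹ * M.likelihood x s a e := by
  rw [posterior, if_neg (by simp [h0, h1])]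
  exact (withDensity_smul _ (M.measurable_likelihood_apply x s a)).symm

variable [Fintype S]

theorem lintegral_instanceLikelihood {h : ℕ} (x : History S K N h) :
    ∫⁻ t, M.instanceLikelihood x t ∂M.instancePrior =
      ∏ i : S × Fin K, M.evidence x i.1 i.2 :=
  lintegral_fintype_prod_eq_prod (μ := fun i : S × Fin K => M.prior i.1 i.2)
    (f := fun i => M.likelihood x i.1 i.2) fun i => M.measurable_likelihood_apply x i.1 i.2

variable [NeZero K]

/-- Bayes' formula for the probability that `a` is the optimal arm. -/
theorem setLIntegral_instanceLikelihood {h : ℕ} {x : History S K N h}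
    (hx : ∏ i : S × Fin K, M.evidence x i.1 i.2 ≠ ∞) (s : S) (a : Fin K) :
    ∫⁻ t in {t | M.optArm t s = a}, M.instanceLikelihood x t ∂M.instancePrior =
      M.thompson N h x s a * ∫⁻ t, M.instanceLikelihood x t ∂M.instancePrior := by
  -- If some evidence vanishes, both sides are 0, so the conventional value of the posterior is
  -- immaterial.
  by_cases h0 : ∃ i : S × Fin K, M.evidence x i.1 i.2 = 0
  · obtain ⟨i, hi⟩ := h0
    have hz : ∫⁻ t, M.instanceLikelihood x t ∂M.instancePrior = 0 := by
      rw [lintegral_instanceLikelihood]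
      exact Finset.prod_eq_zero (Finset.mem_univ i) hi
    rw [hz, mul_zero]
    exact le_antisymm ((setLIntegral_le_lintegral _ _).trans hz.le) zero_le
  · push Not at h0
    -- With no factor 0, a single infinite factor would make the whole product infinite.
    have h1 (i : S × Fin K) : M.evidence x i.1 i.2 ≠ ∞ := by
      intro hi
      refine hx ?_
      classical
      rw [← Finset.mul_prod_erase _ _ (Finset.mem_univ i), hi, ENNReal.top_mul]
      exact Finset.prod_ne_zero_iff.2 fun j _ => h0 j
    have hL (i : S × Fin K) : Measurable (M.likelihood x i.1 i.2) :=
      M.measurable_likelihood_apply x i.1 i.2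
    have hprob (i : S × Fin K) : IsProbabilityMeasure ((M.prior i.1 i.2).withDensity fun e =>
        (M.evidence x i.1 i.2)⁻¹ * M.likelihood x i.1 i.2 e) := by
      rw [← M.posterior_eq_withDensity (h0 i) (h1 i)]
      infer_instance
    have hpi : Measure.pi (fun i : S × Fin K => M.posterior x i.1 i.2) =
        M.instancePrior.withDensity fun t =>
          (∏ i : S × Fin K, (M.evidence x i.1 i.2)⁻¹) * M.instanceLikelihood x t := by
      simp only [M.posterior_eq_withDensity (h0 (_, _)) (h1 (_, _)), instanceLikelihood,
        ← Finset.prod_mul_distrib]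
      exact Measure.pi_withDensity fun i : S × Fin K => (hL i).const_mul _
    have hLm : Measurable (M.instanceLikelihood x) := by
      have := M.measurable_instanceLikelihood.comp (measurable_prodMk_left (x := x))
      exact this
    rw [thompson_eq_pi_optArm, hpi, withDensity_apply _ (M.measurableSet_optArm s a),
      lintegral_const_mul _ hLm, lintegral_instanceLikelihood, mul_right_comm,
      ← Finset.prod_mul_distrib,
      Finset.prod_eq_one fun i _ => ENNReal.inv_mul_cancel (h0 i) (h1 i), one_mul]

variable {M}

/-- Thompson sampling plays each arm with its posterior probability of being optimal. -/
theorem IsInteraction.measure_optArm_inter {Ω : Type*} [MeasurableSpace Ω] {P : Measure Ω}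
    [IsProbabilityMeasure P] {π : Policy S K N} {θ : Ω → S × Fin K → E}
    {Y : ℕ → Ω → Fin N → S × Fin K × ℝ}
    (hI : M.IsInteraction π P θ Y)
    (hπ : ∀ h s a, Measurable fun x => π h x s a) {h : ℕ} (s : S) (a : Fin K)
    {C : Set (History S K N h)} (hC : MeasurableSet C) :
    P ({ω | M.optArm (θ ω) s = a} ∩ past Y h ⁻¹' C) =
      ∫⁻ ω in past Y h ⁻¹' C, M.thompson N h (past Y h ω) s a ∂P := by
  obtain ⟨Λ, hΛ, hf⟩ := hI.exists_lintegral_eq hπ h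
  have hOm : MeasurableSet {ω | M.optArm (θ ω) s = a} :=
    hI.measurable_instance (M.measurableSet_optArm s a)
  have hCm : MeasurableSet (past Y h ⁻¹' C) := hI.measurable_past h hC
  have hLm (x : History S K N h) : Measurable (M.instanceLikelihood x) := by
    have := M.measurable_instanceLikelihood.comp (measurable_prodMk_left (x := x))
    exact this
  -- The product of evidences is the density of the history's law with respect to `Λ`, so its
  -- integral is 1.
  have hfin : ∀ᵐ x ∂Λ, ∏ i : S × Fin K, M.evidence x i.1 i.2 < ∞ := by
    refine ae_lt_top (Finset.measurable_prod _ fun i _ => M.measurable_evidence i.1 i.2) ?_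
    have := hf (fun _ => 1) measurable_const
    simp only [one_mul, lintegral_instanceLikelihood] at this
    rw [← this]
    simp
  have hT := M.measurable_thompson (N := N) (h := h) s a
  have hSm : MeasurableSet ({t | M.optArm t s = a} ×ˢ C) := (M.measurableSet_optArm s a).prod hC
  have h1 := hf (({t | M.optArm t s = a} ×ˢ C).indicator 1) (measurable_one.indicator hSm)
  have h2 := hf (fun z => C.indicator (fun x => M.thompson N h x s a) z.2)
    ((hT.indicator hC).comp measurable_snd)
  calc
    _ = ∫⁻ ω, ({t | M.optArm t s = a} ×ˢ C).indicator 1 (θ ω, past Y h ω) ∂P := by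
      rw [← lintegral_indicator_one (hOm.inter hCm)]
      rfl
    _ = ∫⁻ ω, C.indicator (fun x => M.thompson N h x s a) (past Y h ω) ∂P := by
      rw [h1, h2]
      refine lintegral_congr_ae ?_
      filter_upwards [hfin] with x hx
      rw [lintegral_const_mul _ (hLm x)]
      by_cases hxC : x ∈ C
      · rw [Set.indicator_of_mem hxC, ← M.setLIntegral_instanceLikelihood hx.ne,
          ← lintegral_indicator (M.measurableSet_optArm s a)]
        refine lintegral_congr fun t => ?_
        by_cases ht : M.optArm t s = a
        · simp [Set.indicator, ht, hxC]
        · simp [Set.indicator, ht]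
      · simp [Set.indicator, hxC]
    _ = _ := by
      rw [← lintegral_indicator hCm]
      rfl

end BayesBandit

/-! ### Two limit arguments: Cesàro with Fatou, and a triangular zero pattern. -/

namespace MeasureTheory

/-- If nonnegative expectations have Cesàro means tending to `0`, the pointwise limit vanishes. -/
theorem ae_nonpos_of_lintegral_sum_le {Ω : Type*} [MeasurableSpace Ω] {P : Measure Ω}
    {G : ℕ → Ω → ℝ} {L : Ω → ℝ} {b : ℕ → ℝ≥0∞} (hG : ∀ h, Measurable (G h))
    (hL : ∀ᵐ ω ∂P, Tendsto (fun h => G h ω) atTop (𝓝 (L ω)))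
    (hb : ∀ H, ∫⁻ ω, ENNReal.ofReal (∑ h ∈ Finset.range H, G h ω) ∂P ≤ b H)
    (hb0 : Tendsto (fun H : ℕ => b H / (H : ℝ≥0∞)) atTop (𝓝 0)) : ∀ᵐ ω ∂P, L ω ≤ 0 := by
  let u : ℕ → Ω → ℝ≥0∞ := fun H ω =>
    ENNReal.ofReal ((H : ℝ)⁻¹ * ∑ h ∈ Finset.range H, G h ω)
  have hS (H : ℕ) : Measurable fun ω => ∑ h ∈ Finset.range H, G h ω :=
    Finset.measurable_sum _ fun h _ => hG h
  have hu (H : ℕ) : Measurable (u H) := ((hS H).const_mul _).ennreal_ofReal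
  have hle (H : ℕ) : ∫⁻ ω, u H ω ∂P ≤ b H / (H : ℝ≥0∞) := by
    -- At `H = 0` the real inverse is 0 and the extended one is `∞`, hence only an inequality.
    have hinv : ENNReal.ofReal (H : ℝ)⁻¹ ≤ (H : ℝ≥0∞)⁻¹ := by
      rcases H.eq_zero_or_pos with rfl | hH
      · simp
      · rw [ENNReal.ofReal_inv_of_pos (by exact_mod_cast hH), ENNReal.ofReal_natCast]
    have hmul (ω : Ω) : u H ω =
        ENNReal.ofReal (H : ℝ)⁻¹ * ENNReal.ofReal (∑ h ∈ Finset.range H, G h ω) :=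
      ENNReal.ofReal_mul (by positivity)
    simp_rw [hmul]
    rw [lintegral_const_mul _ (hS H).ennreal_ofReal, mul_comm, div_eq_mul_inv]
    exact mul_le_mul' (hb H) hinv
  have hlim : ∫⁻ ω, liminf (fun H => u H ω) atTop ∂P = 0 := by
    refine le_antisymm ((lintegral_liminf_le hu).trans ?_) zero_le
    refine (liminf_le_liminf (Eventually.of_forall hle)).trans ?_
    exact hb0.liminf_eq.le
  rw [lintegral_eq_zero_iff (Measurable.liminf hu)] at hlim
  filter_upwards [hlim, hL] with ω h1 h2
  have h3 : Tendsto (fun H => u H ω) atTop (𝓝 (ENNReal.ofReal (L ω))) :=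
    (ENNReal.continuous_ofReal.tendsto _).comp h2.cesaro
  rw [h3.liminf_eq] at h1
  exact ENNReal.ofReal_eq_zero.1 h1

/-- A conditional law of `A` that vanishes below `A` is concentrated at `A`. -/
theorem ae_condExp_indicator_eq_ite {Ω ι : Type*} [Fintype ι] [LinearOrder ι] [MeasurableSpace ι]
    [MeasurableSingletonClass ι] {m m0 : MeasurableSpace Ω} {P : Measure Ω} [IsProbabilityMeasure P]
    (hm : m ≤ m0) {A : Ω → ι} (hA : Measurable A)
    (hlt : ∀ a, ∀ᵐ ω ∂P, a < A ω → P[(A ⁻¹' {a}).indicator (1 : Ω → ℝ) | m] ω = 0) :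
    ∀ᵐ ω ∂P, ∀ a, P[(A ⁻¹' {a}).indicator (1 : Ω → ℝ) | m] ω = if A ω = a then 1 else 0 := by
  let I : ι → Ω → ℝ := fun a => (A ⁻¹' {a}).indicator 1
  have hAm (a : ι) : MeasurableSet (A ⁻¹' {a}) := hA (measurableSet_singleton a)
  have hI (a : ι) : Integrable (I a) P := (integrable_const (1 : ℝ)).indicator (hAm a)
  have hpI (a b : ι) : P[I a | m] * I b = (A ⁻¹' {b}).indicator (P[I a | m]) := by
    ext ω
    by_cases h : ω ∈ A ⁻¹' {b}
    · simp [I, Set.indicator_of_mem h]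
    · simp [I, Set.indicator_of_notMem h]
  have hint (a b : ι) : Integrable (P[I a | m] * I b) P := by
    rw [hpI]
    exact integrable_condExp.indicator (hAm b)
  have hpull (a b : ι) : P[P[I a | m] * I b | m] =ᵐ[P] P[I a | m] * P[I b | m] :=
    condExp_mul_of_stronglyMeasurable_left stronglyMeasurable_condExp (hint a b) (hI b)
  have hnonneg (a : ι) : 0 ≤ᵐ[P] P[I a | m] :=
    condExp_nonneg (Eventually.of_forall fun ω => Set.indicator_nonneg (fun _ _ => zero_le_one) ω)
  -- On `A = b` with `a < b` the hypothesis applies; conditioning on `m` then replaces the indicator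
  -- of `A = b` by its conditional probability.
  have hprod_lt (a b : ι) (hab : a < b) : P[I a | m] * P[I b | m] =ᵐ[P] 0 := by
    have h0 : P[I a | m] * I b =ᵐ[P] 0 := by
      filter_upwards [hlt a] with ω hω
      rw [hpI]
      refine Set.indicator_apply_eq_zero.2 fun hb => hω ?_
      rw [Set.mem_preimage, Set.mem_singleton_iff] at hb
      rwa [hb]
    refine (hpull a b).symm.trans ((condExp_congr_ae h0).trans ?_)
    rw [condExp_zero]
  have hprod (a b : ι) (hab : a ≠ b) : P[I a | m] * P[I b | m] =ᵐ[P] 0 := by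
    rcases hab.lt_or_gt with h | h
    · exact hprod_lt a b h
    · rw [mul_comm]
      exact hprod_lt b a h
  -- The nonnegative left side has the same expectation as the product of the two conditional
  -- probabilities, which is 0.
  have hoff (a b : ι) (hab : a ≠ b) : P[I a | m] * I b =ᵐ[P] 0 := by
    have hnn : 0 ≤ᵐ[P] P[I a | m] * I b := by
      filter_upwards [hnonneg a] with ω hω
      exact mul_nonneg hω (Set.indicator_nonneg (fun _ _ => zero_le_one) ω)
    rw [← integral_eq_zero_iff_of_nonneg_ae hnn (hint a b), ← integral_condExp hm,
      integral_congr_ae ((hpull a b).trans (hprod a b hab))]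
    simp
  have hsum : ∀ᵐ ω ∂P, ∑ a, P[I a | m] ω = 1 := by
    have h1 : ∑ a, I a = fun _ => 1 := by
      ext ω
      rw [Finset.sum_apply, Finset.sum_eq_single (A ω)]
      · simp [I]
      · intro c _ hc
        simp [I, Ne.symm hc]
      · simp
    have h2 := condExp_finsetSum (μ := P) (s := Finset.univ) (fun a _ => hI a) m
    rw [h1, condExp_const hm] at h2
    filter_upwards [h2] with ω hω
    rw [Finset.sum_apply] at hω
    exact hω.symm
  have hoff' : ∀ᵐ ω ∂P, ∀ a b, a ≠ b → P[I a | m] ω * I b ω = 0 := by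
    simp only [ae_all_iff]
    exact fun a b hab => hoff a b hab
  filter_upwards [hsum, hoff'] with ω h1 h2 a
  have h3 : ∀ c, c ≠ A ω → P[I c | m] ω = 0 := fun c hc => by
    simpa [I] using h2 c (A ω) hc
  split_ifs with ha
  · rw [Finset.sum_eq_single (A ω) (fun c _ hc => h3 c hc) (by simp)] at h1
    rwa [← ha]
  · exact h3 a (Ne.symm ha)

end MeasureTheory

/-! ### Almost sure convergence of Thompson sampling. -/

noncomputable section

namespace BayesBandit

variable {S : Type*} {K : ℕ} {E : Type*} [MeasurableSpace E] {M : BayesBandit S K E}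
  [Fintype S] [MeasurableSpace S] {N : ℕ} {π : Policy S K N}
  {Ω : Type*} [mΩ : MeasurableSpace Ω] {P : Measure Ω} {θ : Ω → S × Fin K → E}
  {Y : ℕ → Ω → Fin N → S × Fin K × ℝ}

/-- The information available before each round. -/
def IsInteraction.pastFiltration (hI : M.IsInteraction π P θ Y) : Filtration ℕ mΩ where
  seq h := MeasurableSpace.comap (past Y h) inferInstance
  mono' := by
    intro h k hhk
    have : past Y h = (fun x : History S K N k => fun i => x (Fin.castLE hhk i)) ∘ past Y k := rfl
    change MeasurableSpace.comap (past Y h) _ ≤ _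
    rw [this, ← MeasurableSpace.comap_comp]
    exact MeasurableSpace.comap_mono
      (measurable_pi_lambda _ fun i => measurable_pi_apply _).comap_le
  le' h := (hI.measurable_past h).comap_le

variable [NeZero K]

theorem IsInteraction.measurable_optArm (hI : M.IsInteraction π P θ Y) (s : S) :
    Measurable fun ω => M.optArm (θ ω) s :=
  (M.measurable_optArm s).comp hI.measurable_instance

variable [MeasurableSingletonClass S]

theorem IsInteraction.thompson_ae_eq_condExp [IsProbabilityMeasure P]
    (hI : M.IsInteraction π P θ Y) (hπ : ∀ h s a, Measurable fun x => π h x s a)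
    (h : ℕ) (s : S) (a : Fin K) :
    (fun ω => (M.thompson N h (past Y h ω) s a).toReal) =ᵐ[P]
      P[((fun ω => M.optArm (θ ω) s) ⁻¹' {a}).indicator (1 : Ω → ℝ) | hI.pastFiltration h] := by
  have hA : MeasurableSet ((fun ω => M.optArm (θ ω) s) ⁻¹' {a}) :=
    hI.measurable_optArm s (measurableSet_singleton a)
  have hT := M.measurable_thompson (N := N) (h := h) s a
  have hTY : Measurable fun ω => M.thompson N h (past Y h ω) s a := hT.comp (hI.measurable_past h)
  have hint : Integrable (fun ω => (M.thompson N h (past Y h ω) s a).toReal) P := by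
    refine Integrable.of_bound hTY.ennreal_toReal.aestronglyMeasurable 1
      (Eventually.of_forall fun ω => ?_)
    rw [Real.norm_of_nonneg ENNReal.toReal_nonneg]
    exact ENNReal.toReal_le_of_le_ofReal zero_le_one (by simpa using M.thompson_le_one _ s a)
  refine ae_eq_condExp_of_forall_setIntegral_eq (hI.pastFiltration.le h)
    ((integrable_const (1 : ℝ)).indicator hA) (fun _ _ _ => hint.integrableOn) ?_ ?_
  · rintro _ ⟨C, hC, rfl⟩ -
    rw [integral_toReal hTY.aemeasurable (Eventually.of_forall fun ω =>
        (M.thompson_le_one _ s a).trans_lt ENNReal.one_lt_top),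
      ← hI.measure_optArm_inter hπ s a hC, integral_indicator_one hA, measureReal_restrict_apply hA]
    rfl
  · have : Measurable[hI.pastFiltration h] fun ω => (M.thompson N h (past Y h ω) s a).toReal :=
      hT.ennreal_toReal.comp (comap_measurable (past Y h))
    exact this.stronglyMeasurable.aestronglyMeasurable

theorem IsInteraction.ae_tendsto_thompson [IsProbabilityMeasure P]
    (hI : M.IsInteraction π P θ Y) (hπ : ∀ h s a, Measurable fun x => π h x s a)
    (s : S) (a : Fin K) :
    ∀ᵐ ω ∂P, Tendsto (fun h => (M.thompson N h (past Y h ω) s a).toReal) atTop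
      (𝓝 (P[((fun ω => M.optArm (θ ω) s) ⁻¹' {a}).indicator (1 : Ω → ℝ) |
        ⨆ h, hI.pastFiltration h] ω)) := by
  filter_upwards [tendsto_ae_condExp (ℱ := hI.pastFiltration)
    (((fun ω => M.optArm (θ ω) s) ⁻¹' {a}).indicator (1 : Ω → ℝ)),
    ae_all_iff.2 fun h => hI.thompson_ae_eq_condExp hπ h s a] with ω h1 h2
  exact h1.congr fun h => (h2 h).symm

/-- On the event that all agents meet `s` and play `a`, one agent's regret already bounds the round
from below. The power `N` is harmless, since only the vanishing of the limit will matter. -/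
theorem IsInteraction.lintegral_sum_gap_le_bayesRegret [IsProbabilityMeasure P]
    (hI : M.IsInteraction π P θ Y) (hπ : ∀ h s a, Measurable fun x => π h x s a)
    (hπ_top : ∀ h x s a, π h x s a ≠ ∞) (hN : 0 < N) (s : S) (a : Fin K) (H : ℕ) :
    ∫⁻ ω, ENNReal.ofReal (∑ h ∈ Finset.range H, M.gap (θ ω) s a *
        ((M.stateLaw s).toReal * (π h (past Y h ω) s a).toReal) ^ N) ∂P ≤
      M.bayesRegret P θ Y H := by
  have hgm : Measurable fun ω => M.gap (θ ω) s a :=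
    (M.measurable_gap s a).comp hI.measurable_instance
  let A : ℕ → Set Ω := fun h => {ω | ∀ n, (Y h ω n).1 = s ∧ (Y h ω n).2.1 = a}
  have hA (h : ℕ) : MeasurableSet (A h) := hI.measurableSet_round h (fun _ => s) fun _ => a
  have hterm (h : ℕ) (ω : Ω) : ENNReal.ofReal (M.gap (θ ω) s a *
        ((M.stateLaw s).toReal * (π h (past Y h ω) s a).toReal) ^ N) =
      ENNReal.ofReal (M.gap (θ ω) s a) * (M.stateLaw s * π h (past Y h ω) s a) ^ N := by
    rw [ENNReal.ofReal_mul (M.gap_nonneg _ _ _), ENNReal.ofReal_pow (by positivity),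
      ENNReal.ofReal_mul ENNReal.toReal_nonneg, ENNReal.ofReal_toReal (M.stateLaw.apply_ne_top s),
      ENNReal.ofReal_toReal (hπ_top _ _ _ _)]
  have hmeas (h : ℕ) : Measurable fun ω =>
      ENNReal.ofReal (M.gap (θ ω) s a) * (M.stateLaw s * π h (past Y h ω) s a) ^ N :=
    hgm.ennreal_ofReal.mul
      ((((hπ h s a).comp (hI.measurable_past h)).const_mul _).pow_const N)
  calc
    _ = ∑ h ∈ Finset.range H, ∫⁻ ω, ENNReal.ofReal (M.gap (θ ω) s a) *
          (M.stateLaw s * π h (past Y h ω) s a) ^ N ∂P := by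
      rw [← lintegral_finsetSum _ fun h _ => hmeas h]
      refine lintegral_congr fun ω => ?_
      rw [ENNReal.ofReal_sum_of_nonneg fun h _ =>
        mul_nonneg (M.gap_nonneg _ _ _) (by positivity)]
      exact Finset.sum_congr rfl fun h _ => hterm h ω
    _ = ∑ h ∈ Finset.range H,
          ∫⁻ ω, (A h).indicator (fun ω => ENNReal.ofReal (M.gap (θ ω) s a)) ω ∂P := by
      refine Finset.sum_congr rfl fun h _ => ?_
      rw [lintegral_indicator (hA h)]
      exact (hI.setLIntegral_round_const (hπ h) s a
        (M.measurable_gap s a).ennreal_ofReal).symm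
    _ = ∫⁻ ω, ∑ h ∈ Finset.range H,
          (A h).indicator (fun ω => ENNReal.ofReal (M.gap (θ ω) s a)) ω ∂P :=
      (lintegral_finsetSum _ fun h _ => hgm.ennreal_ofReal.indicator (hA h)).symm
    _ ≤ _ := by
      refine lintegral_mono fun ω => ?_
      rw [ENNReal.ofReal_sum_of_nonneg fun h _ => Finset.sum_nonneg fun n _ => M.gap_nonneg _ _ _]
      refine Finset.sum_le_sum fun h _ => ?_
      by_cases hω : ω ∈ A h
      · rw [Set.indicator_of_mem hω]
        refine ENNReal.ofReal_le_ofReal (le_trans (le_of_eq ?_) (Finset.single_le_sum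
          (f := fun n => M.gap (θ ω) (Y h ω n).1 (Y h ω n).2.1)
          (fun n _ => M.gap_nonneg _ _ _) (Finset.mem_univ (⟨0, hN⟩ : Fin N))))
        simp only [(hω ⟨0, hN⟩).1, (hω ⟨0, hN⟩).2]
      · rw [Set.indicator_of_notMem hω]
        exact zero_le

/-- Under sub-linear regret, Thompson sampling converges to the optimal policy. -/
theorem IsInteraction.ae_tendsto_thompson_optPolicy [IsProbabilityMeasure P]
    (hI : M.IsInteraction (M.thompson N) P θ Y) (hN : 0 < N)
    (hreg : Tendsto (fun H : ℕ => M.bayesRegret P θ Y H / (H : ℝ≥0∞)) atTop (𝓝 0)) :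
    ∀ᵐ ω ∂P, ∀ s, M.stateLaw s ≠ 0 → ∀ a,
      Tendsto (fun h => (M.thompson N h (past Y h ω) s a).toReal) atTop
        (𝓝 (M.optPolicy (θ ω) s a).toReal) := by
  have hπ (h : ℕ) (s : S) (a : Fin K) := M.measurable_thompson (N := N) (h := h) s a
  have hlim := hI.ae_tendsto_thompson hπ
  refine ae_all_iff.2 fun s => ?_
  rw [eventually_imp_distrib_left]
  intro hs
  have hs' : 0 < (M.stateLaw s).toReal := ENNReal.toReal_pos hs (M.stateLaw.apply_ne_top s)
  have hite := ae_condExp_indicator_eq_ite (P := P)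
    (iSup_le fun h => hI.pastFiltration.le h) (hI.measurable_optArm s) fun a => by
      have hz := ae_nonpos_of_lintegral_sum_le (P := P)
        (G := fun h ω => M.gap (θ ω) s a *
          ((M.stateLaw s).toReal * (M.thompson N h (past Y h ω) s a).toReal) ^ N)
        (L := fun ω => M.gap (θ ω) s a * ((M.stateLaw s).toReal *
          P[((fun ω => M.optArm (θ ω) s) ⁻¹' {a}).indicator (1 : Ω → ℝ) |
            ⨆ h, hI.pastFiltration h] ω) ^ N)
        (fun h => ((M.measurable_gap s a).comp hI.measurable_instance).mul
          ((((hπ h s a).comp (hI.measurable_past h)).ennreal_toReal.const_mul _).pow_const N))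
        (by
          filter_upwards [hlim s a] with ω hω
          exact ((hω.const_mul _).pow N).const_mul _)
        (hI.lintegral_sum_gap_le_bayesRegret hπ
          (fun h x s a => ((M.thompson_le_one x s a).trans_lt ENNReal.one_lt_top).ne) hN s a) hreg
      filter_upwards [hz, hlim s a] with ω h1 h2 h3
      have hnn := ge_of_tendsto' h2 fun h => ENNReal.toReal_nonneg
      have hgap := M.gap_pos_of_lt_optArm h3
      -- The gap can be divided out, so a positive limit weight would contradict this bound.
      have hpow := nonpos_of_mul_nonpos_right h1 hgap
      refine hnn.antisymm' (not_lt.1 fun hpos => hpow.not_gt ?_)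
      exact pow_pos (mul_pos hs' hpos) N
  filter_upwards [hite, ae_all_iff.2 (hlim s)] with ω h1 h2 a
  have h3 := h2 a
  rw [h1 a] at h3
  convert h3 using 2
  rw [optPolicy]
  split_ifs <;> simp

end BayesBandit

/-! ### Passage to the information quantities. -/

namespace BayesBandit

variable {S : Type*} {K : ℕ} {E : Type*} [MeasurableSpace E] (M : BayesBandit S K E)

theorem joint_nonneg (p : S → Fin K → ℝ≥0∞) (s : S) (a : Fin K) : 0 ≤ M.joint p s a :=
  mul_nonneg ENNReal.toReal_nonneg ENNReal.toReal_nonneg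

variable [Fintype S]

/-- The action is a function of the state, so H(S, A) = H(S) and the mutual information reduces to
H(A). -/
theorem policyInfo_optPolicy [NeZero K] (t : S × Fin K → E) :
    M.policyInfo (M.optPolicy t) = M.optEntropy t := by
  have hj (s : S) (a : Fin K) : M.joint (M.optPolicy t) s a =
      if M.optArm t s = a then (M.stateLaw s).toReal else 0 := by
    rw [joint, optPolicy]
    split_ifs <;> simp
  rw [policyInfo, mutualInfoBits_eq (M.joint_nonneg _), optEntropy, actionEntropy]
  simp only [hj, entropyBits, ite_mul, zero_mul]
  have h2 (s : S) : (∑ a, if M.optArm t s = a then (M.stateLaw s).toReal *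
      Real.logb 2 (if M.optArm t s = a then (M.stateLaw s).toReal else 0) else 0) =
      (M.stateLaw s).toReal * Real.logb 2 (M.stateLaw s).toReal := by
    rw [Finset.sum_ite_eq]
    simp
  simp only [h2, Finset.sum_ite_eq, Finset.mem_univ, if_true]
  ring

end BayesBandit

end

theorem lemma1 {S : Type*} [Fintype S] [MeasurableSpace S] [MeasurableSingletonClass S]
    {K : ℕ} [NeZero K] {E : Type*} [MeasurableSpace E] (M : BayesBandit S K E)
    (N : ℕ) (hN : 0 < N)
    {Ω : Type*} [MeasurableSpace Ω] (P : Measure Ω) [IsProbabilityMeasure P]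
    (θ : Ω → S × Fin K → E) (Y : ℕ → Ω → Fin N → S × Fin K × ℝ)
    (hTS : M.IsInteraction (M.thompson N) P θ Y)
    (hreg : Tendsto (fun H : ℕ => M.bayesRegret P θ Y H / (H : ℝ≥0∞)) atTop (𝓝 0)) :
    ∀ᵐ ω ∂P,
      Tendsto (fun h => M.policyInfo (M.thompson N h (BayesBandit.past Y h ω)))
        atTop (𝓝 (M.optEntropy (θ ω))) ∧
      Tendsto (fun h => M.actionEntropy (M.thompson N h (BayesBandit.past Y h ω)))
        atTop (𝓝 (M.optEntropy (θ ω))) := by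
  filter_upwards [hTS.ae_tendsto_thompson_optPolicy hN hreg] with ω hω
  have hj : Tendsto (fun h => M.joint (M.thompson N h (BayesBandit.past Y h ω))) atTop
      (𝓝 (M.joint (M.optPolicy (θ ω)))) := by
    refine tendsto_pi_nhds.2 fun s => tendsto_pi_nhds.2 fun a => ?_
    -- In a state of probability 0 the regret does not control the policy, but the joint law is
    -- constantly 0 there.
    by_cases hs : M.stateLaw s = 0
    · simp [BayesBandit.joint, hs]
    · exact (hω s hs a).const_mul _
  refine ⟨?_, (continuous_entropyBits_sum.tendsto _).comp hj⟩
  rw [← M.policyInfo_optPolicy]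
  exact tendsto_mutualInfoBits (fun _ => M.joint_nonneg _) (M.joint_nonneg _) hj
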